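/- Let $p$ be a selective ultrafilter, i.e. a free ultrafilter on $\omega$ such that every function $\omega\to\omega$ is finite-to-one or constant on some member of $p$, and every finite-to-one function $\omega\to\omega$ is one-to-one on some member of $p$. For an abelian group $\mathbb G$ let $\mathsf{ult}_p(\mathbb G)=\mathbb G^\omega/{\equiv}$, where $f\equiv g$ iff $\{n: f(n)=g(n)\}\in p$. Put $\mathsf{ult}_p^0(\mathbb G)=\mathbb G$ and, for every ordinal $\alpha>0$, $$\mathsf{ult}_p^\alpha(\mathbb G)=\mathsf{ult}_p\Bigl(\varinjlim_{\beta<\alpha}\mathsf{ult}_p^\beta(\mathbb G)\Bigr),$$ where, for $\delta<\beta$, the map $\mathsf{ult}_p^\delta(\mathbb G)\to\mathsf{ult}_p^\beta(\mathbb G)$ of the direct system sends $a$ to the class of the constant sequence whose value is the image of $a$ in $\varinjlim_{\gamma<\beta}\mathsf{ult}_p^\gamma(\mathbb G)$. Every homomorphism $\Phi:\mathbb G\to\mathbb T=\mathbb R/\mathbb Z$ extends recursively to homomorphisms $\overline\Phi:\mathsf{ult}_p^\alpha(\mathbb G)\to\mathbb T$ by $\overline\Phi([f])=p\text{-}\lim_{n}\overline\Phi(f(n))$.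 Endow $\mathsf{ult}_p^{\omega_1}(\mathbb G)$ with the weakest topology making all $\overline\Phi$, $\Phi\in\mathrm{Hom}(\mathbb G,\mathbb T)$, continuous, and let $\mathsf{Ult}_p^{\omega_1}(\mathbb G)=\mathsf{ult}_p^{\omega_1}(\mathbb G)/K$ with the quotient topology, where $K=\bigcap_{\Phi\in\mathrm{Hom}(\mathbb G,\mathbb T)}\ker\overline\Phi$. Let $[\omega]^{<\omega}$ be the group of finite subsets of $\omega$ with the symmetric difference. Then $\mathsf{Ult}_p^{\omega_1}([\omega]^{<\omega})$ is a Hausdorff topological group in which $x+x=0$ for every $x$; it is $p$-compact, i.e. for every sequence $(x_n)_{n\in\omega}$ there is a point $x$ such that $\{n: x_n\in U\}\in p$ for every open $U\ni x$; and it has no non-trivial convergent sequences, i.e. every convergent sequence is eventually constant. -/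

import Mathlib

noncomputable section

open Filter Topology CategoryTheory

namespace IteratedUltrapower

/-! ### Ultrafilters on `ω` -/

/-- Every function on `ω` is constant or finite-to-one on some member of `p`. -/
def IsPPoint (p : Ultrafilter ℕ) : Prop :=
  ∀ f : ℕ → ℕ, ∃ U ∈ p, (∃ c, ∀ n ∈ U, f n = c) ∨ ∀ m, {n | n ∈ U ∧ f n = m}.Finite

/-- Every finite-to-one function on `ω` is one-to-one on some member of `p`. -/
def IsQPoint (p : Ultrafilter ℕ) : Prop :=
  ∀ f : ℕ → ℕ, (∀ m, {n | f n = m}.Finite) → ∃ U ∈ p, Set.InjOn f U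

/-- A selective ultrafilter: a free ultrafilter on `ω` that is a P-point and a Q-point. -/
structure IsSelective (p : Ultrafilter ℕ) : Prop where
  free : (p : Filter ℕ) ≤ cofinite
  isPPoint : IsPPoint p
  isQPoint : IsQPoint p

/-! ### Topological notions -/

/-- Every sequence of points of `X` has a `p`-limit in `X`. -/
def IsPCompact (p : Ultrafilter ℕ) (X : Type) [TopologicalSpace X] : Prop :=
  ∀ x : ℕ → X, ∃ a, Tendsto x (p : Filter ℕ) (𝓝 a)

/-- `X` has no non-trivial convergent sequences: a sequence that converges to `a` is
eventually equal to `a`. -/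
def NoNontrivialConvergentSeq (X : Type) [TopologicalSpace X] : Prop :=
  ∀ (x : ℕ → X) (a : X), Tendsto x atTop (𝓝 a) → ∀ᶠ n in atTop, x n = a

/-! ### The ultrapower of an abelian group -/

/-- The ultrapower `ult_p(G) = G^ω / ≡`, where `f ≡ g` iff `{n | f n = g n} ∈ p`. -/
abbrev Ultrapower (p : Ultrafilter ℕ) (G : Type) : Type := Germ (p : Filter ℕ) G

/-- The canonical embedding `G → ult_p(G)`: constant sequences. -/
def constHom (p : Ultrafilter ℕ) (G : Type) [AddCommGroup G] : G →+ Ultrapower p G where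
  toFun g := ((fun _ => g : ℕ → G) : Ultrapower p G)
  map_zero' := rfl
  map_add' _ _ := rfl

theorem tendsto_limUnder (p : Ultrafilter ℕ) (x : ℕ → UnitAddCircle) :
    Tendsto x (p : Filter ℕ) (𝓝 (limUnder (p : Filter ℕ) x)) := by
  obtain ⟨a, -, ha⟩ := isCompact_univ.ultrafilter_le_nhds (p.map x) (by simp)
  exact tendsto_nhds_limUnder ⟨a, ha⟩

/-- The extension of a homomorphism `Φ : G → 𝕋 = ℝ/ℤ` to the ultrapower `ult_p(G)`, given by
`[f] ↦ p-lim Φ (f n)`. -/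
def ultrapowerExt (p : Ultrafilter ℕ) {G : Type} [AddCommGroup G] (Φ : G →+ UnitAddCircle) :
    Ultrapower p G →+ UnitAddCircle where
  toFun x := Quotient.liftOn x (fun f => limUnder (p : Filter ℕ) fun n => Φ (f n))
    (fun f g (h : f =ᶠ[(p : Filter ℕ)] g) => by
      have : (fun n => Φ (f n)) =ᶠ[(p : Filter ℕ)] fun n => Φ (g n) :=
        h.mono fun n hn => congrArg Φ hn
      simp only [limUnder, Filter.map_congr this])
  map_zero' := by
    refine Tendsto.limUnder_eq (f := (p : Filter ℕ)) ?_
    simp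
  map_add' := by
    rintro ⟨f⟩ ⟨g⟩
    refine Tendsto.limUnder_eq (f := (p : Filter ℕ)) ?_
    simp only [map_add]
    exact (tendsto_limUnder p fun n => Φ (f n)).add (tendsto_limUnder p fun n => Φ (g n))

theorem ultrapowerExt_coe (p : Ultrafilter ℕ) {G : Type} [AddCommGroup G]
    (Φ : G →+ UnitAddCircle) (f : ℕ → G) :
    ultrapowerExt p Φ (f : Ultrapower p G) = limUnder (p : Filter ℕ) fun n => Φ (f n) := rfl

theorem ultrapowerExt_const (p : Ultrafilter ℕ) {G : Type} [AddCommGroup G]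
    (Φ : G →+ UnitAddCircle) (g : G) : ultrapowerExt p Φ (constHom p G g) = Φ g :=
  Tendsto.limUnder_eq (f := (p : Filter ℕ)) tendsto_const_nhds

/-! ### The iterated ultrapowers

Fix a well-ordered set `I`; its elements play the role of the ordinals below the order type
of `I`. By recursion on `i : I` we construct the groups `ult i` and the canonical maps
`φ j i : ult j → ult i` for `j ≤ i`, so that

* `ult i = G` if `i` is the least element of `I`,
* `ult i = ult_p (lim_{j < i} ult j)` otherwise, and
* `φ j i a` is the class of the constant sequence with value (the image in `lim_{j < i} ult j` of)
  `a`, for `j < i`.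

These three facts are `ultEquivBot`, `ultEquiv` and `ultEquiv_φ` below. -/

variable {I : Type} [LinearOrder I]

/-- What the recursion produces at one step: a group, and the canonical maps into it from the
groups of the earlier steps. Only the map `fromStage j Y` where `Y` is the group of the
`j`-th step matters; it is zero for all other `Y`. -/
structure Stage (I : Type) : Type 1 where
  carrier : AddCommGrpCat.{0}
  fromStage : I → ∀ Y : AddCommGrpCat.{0}, Y →+ carrier

/-- The canonical map from the group of step `j` to that of step `k`, for `j ≤ k`, where `S`
and `T` are the outcomes of these steps; it is the identity if `j = k`. -/
def transition (j k : I) (S T : Stage I) : S.carrier →+ T.carrier :=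
  open Classical in
  if h : j = k ∧ S.carrier = T.carrier then (eqToHom h.2).hom else T.fromStage j S.carrier

/-- The direct limit of the groups constructed before step `i`. -/
abbrev stageLim (i : I) (d : {j // j < i} → Stage I) : Type :=
  AddCommGroup.DirectLimit (fun j => (d j).carrier)
    (fun j k _ => transition j.1 k.1 (d j) (d k))

/-- One step of the recursion. -/
def stageStep (p : Ultrafilter ℕ) (G : Type) [AddCommGroup G] (i : I)
    (d : {j // j < i} → Stage I) : Stage I :=
  open Classical in
  if IsMin i then ⟨AddCommGrpCat.of G, fun _ _ => 0⟩
  else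
    { carrier := AddCommGrpCat.of (Ultrapower p (stageLim i d))
      fromStage := fun j Y =>
        if h : ∃ hj : j < i, Y = (d ⟨j, hj⟩).carrier then
          ((constHom p (stageLim i d)).comp
            (AddCommGroup.DirectLimit.of (fun j => (d j).carrier)
              (fun j k _ => transition j.1 k.1 (d j) (d k)) ⟨j, h.1⟩)).comp (eqToHom h.2).hom
        else 0 }

variable [WellFoundedLT I]

/-- The recursion. -/
def stage (p : Ultrafilter ℕ) (G : Type) [AddCommGroup G] : I → Stage I :=
  (wellFounded_lt (α := I)).fix fun i d => stageStep p G i fun j => d j.1 j.2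

theorem stage_eq (p : Ultrafilter ℕ) (G : Type) [AddCommGroup G] (i : I) :
    stage p G i = stageStep p G i fun j => stage p G j.1 :=
  (wellFounded_lt (α := I)).fix_eq _ i

/-- The `i`-th iterated ultrapower of `G`. -/
def ult (p : Ultrafilter ℕ) (G : Type) [AddCommGroup G] (i : I) : Type :=
  (stage p G i).carrier

instance ultAddCommGroup (p : Ultrafilter ℕ) (G : Type) [AddCommGroup G] (i : I) :
    AddCommGroup (ult p G i) :=
  inferInstanceAs (AddCommGroup (stage p G i).carrier)

/-- The canonical map `ult j → ult i`, for `j ≤ i`. -/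
def φ (p : Ultrafilter ℕ) (G : Type) [AddCommGroup G] (j i : I) : ult p G j →+ ult p G i :=
  transition j i (stage p G j) (stage p G i)

/-- `lim_{j < i} ult j`, the direct limit along the canonical maps. -/
abbrev ultLim (p : Ultrafilter ℕ) (G : Type) [AddCommGroup G] (i : I) : Type :=
  AddCommGroup.DirectLimit (fun j : {j // j < i} => ult p G j.1) (fun j k _ => φ p G j.1 k.1)

/-- The canonical map `ult j → lim_{k < i} ult k`, for `j < i`. -/
abbrev toLim (p : Ultrafilter ℕ) (G : Type) [AddCommGroup G] (i : I) (j : {j // j < i}) :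
    ult p G j.1 →+ ultLim p G i :=
  AddCommGroup.DirectLimit.of (fun j : {j // j < i} => ult p G j.1) (fun j k _ => φ p G j.1 k.1) j

theorem stage_of_isMin (p : Ultrafilter ℕ) (G : Type) [AddCommGroup G] {i : I} (hi : IsMin i) :
    stage p G i = ⟨AddCommGrpCat.of G, fun _ _ => 0⟩ := by
  rw [stage_eq, stageStep, if_pos hi]

theorem stage_of_not_isMin (p : Ultrafilter ℕ) (G : Type) [AddCommGroup G] {i : I}
    (hi : ¬ IsMin i) :
    stage p G i =
      { carrier := AddCommGrpCat.of (Ultrapower p (ultLim p G i))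
        fromStage := fun j Y =>
          open Classical in
          if h : ∃ _ : j < i, Y = (stage p G j).carrier then
            ((constHom p (ultLim p G i)).comp (toLim p G i ⟨j, h.1⟩)).comp (eqToHom h.2).hom
          else 0 } := by
  rw [stage_eq, stageStep, if_neg hi]
  rfl

/-- `ult i = G` if `i` is the least element of `I`. -/
def ultEquivBot (p : Ultrafilter ℕ) (G : Type) [AddCommGroup G] {i : I} (hi : IsMin i) :
    ult p G i ≃+ G :=
  (eqToIso (congrArg Stage.carrier (stage_of_isMin p G hi))).addCommGroupIsoToAddEquiv

/-- `ult i = ult_p (lim_{j < i} ult j)` if `i` is not the least element of `I`. -/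
def ultEquiv (p : Ultrafilter ℕ) (G : Type) [AddCommGroup G] {i : I} (hi : ¬ IsMin i) :
    ult p G i ≃+ Ultrapower p (ultLim p G i) :=
  (eqToIso (congrArg Stage.carrier (stage_of_not_isMin p G hi))).addCommGroupIsoToAddEquiv

theorem φ_self (p : Ultrafilter ℕ) (G : Type) [AddCommGroup G] (i : I) (a : ult p G i) :
    φ p G i i a = a := by
  simp [φ, transition]
  rfl

/-- For `j < i`, the map `φ j i` sends `a` to the class of the constant sequence `a`. -/
theorem ultEquiv_φ (p : Ultrafilter ℕ) (G : Type) [AddCommGroup G] {j i : I} (hji : j < i)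
    (a : ult p G j) :
    ultEquiv p G hji.not_isMin (φ p G j i a) = constHom p _ (toLim p G i ⟨j, hji⟩ a) := by
  have key : ∀ (S : Stage I) (h : stage p G i = S),
      (eqToHom (congrArg Stage.carrier h)).hom (φ p G j i a) =
        S.fromStage j (stage p G j).carrier a := by
    rintro _ rfl
    simp [φ, transition, hji.ne]
    rfl
  refine (key _ (stage_of_not_isMin p G hji.not_isMin)).trans ?_
  simp [hji]
  rfl

/-- The groups `ult i` and the maps `φ` form a direct system. -/
theorem φ_φ (p : Ultrafilter ℕ) (G : Type) [AddCommGroup G] {j k i : I} (hjk : j ≤ k)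
    (hki : k ≤ i) (a : ult p G j) : φ p G k i (φ p G j k a) = φ p G j i a := by
  rcases hki.eq_or_lt with rfl | hki
  · exact φ_self ..
  have hji := hjk.trans_lt hki
  apply (ultEquiv p G hji.not_isMin).injective
  rw [ultEquiv_φ p G hki, ultEquiv_φ p G hji]
  exact congrArg (constHom p _) (AddCommGroup.DirectLimit.of_f
    (f := fun (j k : {j // j < i}) _ => φ p G j.1 k.1) (i := ⟨j, hji⟩) (j := ⟨k, hki⟩) hjk a)

/-! ### The extensions of homomorphisms to the iterated ultrapowers -/

/-- The compatibility of homomorphisms `Ψ j : ult j → 𝕋`, `j < i`, with the canonical maps. -/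
def Compat (p : Ultrafilter ℕ) (G : Type) [AddCommGroup G] (i : I)
    (Ψ : ∀ j : {j // j < i}, ult p G j.1 →+ UnitAddCircle) : Prop :=
  ∀ (j k : {j // j < i}) (_ : j ≤ k) (a : ult p G j.1), Ψ k (φ p G j.1 k.1 a) = Ψ j a

/-- The homomorphism `lim_{j < i} ult j → 𝕋` given by compatible homomorphisms `ult j → 𝕋`. -/
def limExt (p : Ultrafilter ℕ) (G : Type) [AddCommGroup G] (i : I)
    (Ψ : ∀ j : {j // j < i}, ult p G j.1 →+ UnitAddCircle) (h : Compat p G i Ψ) :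
    ultLim p G i →+ UnitAddCircle :=
  AddCommGroup.DirectLimit.lift (fun j : {j // j < i} => ult p G j.1)
    (fun j k _ => φ p G j.1 k.1) UnitAddCircle Ψ h

/-- The extension `Φ̄ : ult i → 𝕋` of `Φ : G → 𝕋`, by recursion on `i`: it is `Φ` if `i` is
the least element, and `Φ̄ [f] = p-lim Φ̄ (f n)` otherwise. The case that the extensions are not
compatible with the canonical maps does not occur, see `compat_ext`. -/
def ext (p : Ultrafilter ℕ) {G : Type} [AddCommGroup G] (Φ : G →+ UnitAddCircle) :
    ∀ i : I, ult p G i →+ UnitAddCircle :=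
  (wellFounded_lt (α := I)).fix fun i Ψ =>
    open Classical in
    if hi : IsMin i then Φ.comp (ultEquivBot p G hi).toAddMonoidHom
    else if h : Compat p G i (fun j => Ψ j.1 j.2) then
      (ultrapowerExt p (limExt p G i _ h)).comp (ultEquiv p G hi).toAddMonoidHom
    else 0

theorem ext_eq (p : Ultrafilter ℕ) {G : Type} [AddCommGroup G] (Φ : G →+ UnitAddCircle) (i : I) :
    ext p Φ i =
      open Classical in
      if hi : IsMin i then Φ.comp (ultEquivBot p G hi).toAddMonoidHom
      else if h : Compat p G i (fun j => ext p Φ j.1) then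
        (ultrapowerExt p (limExt p G i _ h)).comp (ultEquiv p G hi).toAddMonoidHom
      else 0 :=
  (wellFounded_lt (α := I)).fix_eq _ i

theorem compat_ext (p : Ultrafilter ℕ) {G : Type} [AddCommGroup G] (Φ : G →+ UnitAddCircle)
    (i : I) : Compat p G i (fun j => ext p Φ j.1) := by
  induction i using (wellFounded_lt (α := I)).induction with
  | _ i ih =>
    rintro ⟨j, hj⟩ ⟨k, hk⟩ hjk a
    rcases (show j ≤ k from hjk).eq_or_lt with rfl | hjk
    · exact congrArg _ (φ_self p G j a)
    · change ext p Φ k (φ p G j k a) = ext p Φ j a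
      rw [ext_eq p Φ k, dif_neg hjk.not_isMin, dif_pos (ih k hk)]
      change ultrapowerExt p _ (ultEquiv p G hjk.not_isMin (φ p G j k a)) = _
      rw [ultEquiv_φ p G hjk, ultrapowerExt_const]
      exact AddCommGroup.DirectLimit.lift_of ..

/-- `Φ̄` is `Φ` on `ult_p^0(G) = G`. -/
theorem ext_of_isMin (p : Ultrafilter ℕ) {G : Type} [AddCommGroup G] (Φ : G →+ UnitAddCircle)
    {i : I} (hi : IsMin i) (a : ult p G i) : ext p Φ i a = Φ (ultEquivBot p G hi a) := by
  rw [ext_eq, dif_pos hi]; rfl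

/-- `Φ̄ [f] = p-lim Φ̄ (f n)` for `f : ω → lim_{j < i} ult j`. -/
theorem ext_of_not_isMin (p : Ultrafilter ℕ) {G : Type} [AddCommGroup G]
    (Φ : G →+ UnitAddCircle) {i : I} (hi : ¬ IsMin i) (f : ℕ → ultLim p G i) :
    ext p Φ i ((ultEquiv p G hi).symm (f : Ultrapower p (ultLim p G i))) =
      limUnder (p : Filter ℕ) fun n => limExt p G i _ (compat_ext p Φ i) (f n) := by
  rw [ext_eq, dif_neg hi, dif_pos (compat_ext p Φ i)]
  change ultrapowerExt p _ (ultEquiv p G hi ((ultEquiv p G hi).symm _)) = _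
  rw [AddEquiv.apply_symm_apply, ultrapowerExt_coe]

/-! ### The group `Ult_p^{ω₁}(G)` -/

/-- The ordinals `≤ ω₁`. -/
abbrev OmegaOneIndex : Type := WithTop (Ordinal.omega 1 : Ordinal.{0}).ToType

/-- The group `ult_p^{ω₁}(G)`. -/
def UltOmegaOne (p : Ultrafilter ℕ) (G : Type) [AddCommGroup G] : Type :=
  ult p G (⊤ : OmegaOneIndex)

instance ultOmegaOneAddCommGroup (p : Ultrafilter ℕ) (G : Type) [AddCommGroup G] :
    AddCommGroup (UltOmegaOne p G) :=
  inferInstanceAs (AddCommGroup (ult p G (⊤ : OmegaOneIndex)))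

/-- The extension `Φ̄ : ult_p^{ω₁}(G) → 𝕋` of `Φ : G → 𝕋`. -/
def extOmegaOne (p : Ultrafilter ℕ) {G : Type} [AddCommGroup G] (Φ : G →+ UnitAddCircle) :
    UltOmegaOne p G →+ UnitAddCircle :=
  ext p Φ (⊤ : OmegaOneIndex)

/-- The extended Bohr topology: the weakest topology that makes every `Φ̄` continuous. -/
instance extendedBohr (p : Ultrafilter ℕ) (G : Type) [AddCommGroup G] :
    TopologicalSpace (UltOmegaOne p G) :=
  ⨅ Φ : G →+ UnitAddCircle, TopologicalSpace.induced (extOmegaOne p Φ) inferInstance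

/-- The intersection `K` of the kernels of all `Φ̄`. -/
def commonKernel (p : Ultrafilter ℕ) (G : Type) [AddCommGroup G] : AddSubgroup (UltOmegaOne p G) :=
  ⨅ Φ : G →+ UnitAddCircle, (extOmegaOne p Φ).ker

/-- `Ult_p^{ω₁}(G) = ult_p^{ω₁}(G) / K`, with the quotient group structure and the quotient
topology of Mathlib. -/
abbrev HausdorffUlt (p : Ultrafilter ℕ) (G : Type) [AddCommGroup G] : Type :=
  UltOmegaOne p G ⧸ commonKernel p G

/-- The group `[ω]^{<ω}` of finite subsets of `ω`, with the symmetric difference as addition. -/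
abbrev FinSubsets : Type := AsBoolRing (Finset ℕ)

end IteratedUltrapower

end


/-!
The map `x ↦ (Φ ↦ Φ̄ x)` embeds `Ult_p^{ω₁}(G)` into the compact group `𝕋^{Hom(G, 𝕋)}`, and its
image is closed under `p`-limits of sequences because `ω₁` has uncountable cofinality.

Let `q` be a prime with `q G = 0`. A convergent sequence that is not eventually constant yields a
null sequence with infinite range `X` in the image, so it suffices to find `Φ : G → 𝕋` with
`Φ̄ = 1/q` at infinitely many points of `X`. Each point of the image is obtained from points of `G`
by countably many `p`-limits `f n → x`. A character `χ` of the group of all `x` in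
`𝕋^{Hom(G, 𝕋)}` with `q x = 0` need not be continuous, but if, for each of these countably many
limits, `χ (f n - x) = 0` for `p`-almost all `n`, then the restriction `Φ` of `χ` to `G` satisfies
`Φ̄ x = χ x`.

Such a `χ` is constructed from a chain of functionals on finite subspaces over `𝔽_q`. A null
sequence in a Hausdorff vector space over a finite field leaves every finite set of non-zero
vectors. Hence at each step `p`-almost every index `n` is admissible for prescribing
`χ (f n - x) = 0` along finitely many of the sequences, and some new point of `X` can be sent to
`1`. The selectivity of `p` makes it possible to choose the indices so that together they form a
member of `p`.
-/

noncomputable section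

open Filter Topology
open scoped AddSubgroup

namespace IteratedUltrapower

/-! ### Selective ultrafilters -/

section Selective

variable {p : Ultrafilter ℕ}

theorem IsPPoint.exists_pseudoIntersection (hp : IsPPoint p) {W : ℕ → Set ℕ}
    (hW : ∀ m, W m ∈ p) : ∃ U ∈ p, ∀ m, (U \ W m).Finite := by
  let g : ℕ → ℕ := fun n => sInf {m | n ∉ W m}
  obtain ⟨U, hU, ⟨c, hc⟩ | hfin⟩ := hp g
  · refine ⟨U ∩ W c, inter_mem hU (hW c), fun m => Set.Finite.subset Set.finite_empty ?_⟩
    rintro n ⟨⟨hnU, hnc⟩, hnm⟩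
    have hmin : n ∉ W (g n) := Nat.sInf_mem (s := {m | n ∉ W m}) ⟨m, hnm⟩
    exact hmin (hc n hnU ▸ hnc)
  · refine ⟨U, hU, fun m => ((Set.finite_Iic m).biUnion fun k _ => hfin k).subset ?_⟩
    rintro n ⟨hnU, hnm⟩
    exact Set.mem_biUnion (x := g n) (Nat.sInf_le hnm) ⟨hnU, rfl⟩

/-- The left endpoints of consecutive intervals in `ℕ` such that `h` maps the left endpoint of
each interval below its right endpoint. -/
def blockStart (h : ℕ → ℕ) : ℕ → ℕ
  | 0 => 0
  | k + 1 => max (blockStart h k + 1) (h (blockStart h k))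

theorem strictMono_blockStart (h : ℕ → ℕ) : StrictMono (blockStart h) :=
  strictMono_nat_of_lt_succ fun _ => lt_max_of_lt_left (Nat.lt_succ_self _)

theorem exists_mem_block (h : ℕ → ℕ) (n : ℕ) :
    ∃ k, blockStart h k ≤ n ∧ n < blockStart h (k + 1) := by
  induction n with
  | zero => exact ⟨0, le_rfl, lt_max_of_lt_left (Nat.lt_succ_self _)⟩
  | succ n ih =>
    obtain ⟨k, hk, hk'⟩ := ih
    rcases (Nat.succ_le_of_lt hk').lt_or_eq with hlt | heq
    · exact ⟨k, hk.trans n.le_succ, hlt⟩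
    · exact ⟨k + 1, heq.ge, heq.trans_lt (strictMono_blockStart h (Nat.lt_succ_self _))⟩

theorem IsQPoint.exists_sparse (hp : IsQPoint p) {h : ℕ → ℕ} (hh : Monotone h) :
    ∃ U ∈ p, ∀ m ∈ U, ∀ n ∈ U, m < n → h m ≤ n := by
  choose g hg hg' using exists_mem_block h
  obtain ⟨U, hU, hinj⟩ := hp g fun k =>
    (Set.finite_Iio (blockStart h (k + 1))).subset fun n hn => hn ▸ hg' n
  obtain ⟨r, hr⟩ : ∃ r, {n | g n % 2 = r} ∈ p := by
    have : ∀ᶠ n in (p : Filter ℕ), g n % 2 = 0 ∨ g n % 2 = 1 :=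
      Eventually.of_forall fun n => Nat.mod_two_eq_zero_or_one _
    rcases Ultrafilter.eventually_or.1 this with h0 | h1
    exacts [⟨0, h0⟩, ⟨1, h1⟩]
  refine ⟨_, inter_mem hU hr, ?_⟩
  -- Distinct elements lie in blocks with distinct indices of equal parity, so that there is a
  -- whole block between them.
  rintro m ⟨hmU, hm : g m % 2 = r⟩ n ⟨hnU, hn : g n % 2 = r⟩ hmn
  have hne : g m ≠ g n := fun e => hmn.ne (hinj hmU hnU e)
  have hlt : g m < g n + 1 :=
    (strictMono_blockStart h).lt_iff_lt.1 ((hg m).trans_lt (hmn.trans (hg' n)))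
  calc h m ≤ h (blockStart h (g m + 1)) := hh (hg' m).le
    _ ≤ blockStart h (g m + 2) := le_max_right _ _
    _ ≤ blockStart h (g n) := (strictMono_blockStart h).monotone (by omega)
    _ ≤ n := hg n

theorem IsSelective.exists_diagonal (hp : IsSelective p) {W : ℕ → Set ℕ} (hW : ∀ m, W m ∈ p) :
    ∃ U ∈ p, ∀ m ∈ U, ∀ n ∈ U, m < n → n ∈ W m := by
  obtain ⟨U, hU, hfin⟩ := hp.isPPoint.exists_pseudoIntersection hW
  choose b hb using fun m => (hfin m).bddAbove
  obtain ⟨V, hV, hsparse⟩ :=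
    hp.isQPoint.exists_sparse (h := fun m => partialSups b m + 1)
      fun _ _ hmn => Nat.succ_le_succ ((partialSups b).monotone hmn)
  refine ⟨U ∩ V, inter_mem hU hV, fun m hm n hn hmn => by_contra fun hnW => ?_⟩
  have hle : n ≤ b m := hb m ⟨hn.1, hnW⟩
  have hlt : partialSups b m + 1 ≤ n := hsparse m hm.2 n hn.2 hmn
  exact absurd (hle.trans (le_partialSups b m)) (not_le.2 hlt)

/-- The positions `(k, s)`, consisting of a round `k` and a state `s`, that can occur in a game
with initial state `s₀` when increasing moves `< m` are made and the move `n` in round `k` changes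
the state from `s` to `step k s n`. -/
def reachable {σ : Type*} (step : ℕ → σ → ℕ → σ) (s₀ : σ) : ℕ → Set (ℕ × σ)
  | 0 => {(0, s₀)}
  | m + 1 => reachable step s₀ m ∪ (fun t => (t.1 + 1, step t.1 t.2 m)) '' reachable step s₀ m

section Reachable

variable {σ : Type*} {step : ℕ → σ → ℕ → σ} {s₀ : σ}

theorem finite_reachable : ∀ m, (reachable step s₀ m).Finite
  | 0 => Set.finite_singleton _
  | m + 1 => (finite_reachable m).union ((finite_reachable m).image _)

theorem monotone_reachable : Monotone (reachable step s₀) :=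
  monotone_nat_of_le_succ fun _ => Set.subset_union_left

theorem succ_mem_reachable {m k : ℕ} {s : σ} (h : (k, s) ∈ reachable step s₀ m) :
    (k + 1, step k s m) ∈ reachable step s₀ (m + 1) :=
  Or.inr ⟨(k, s), h, rfl⟩

theorem mem_reachable_of_strictMono {u : ℕ → ℕ} (hu : StrictMono u) {s : ℕ → σ} (h₀ : s 0 = s₀)
    (hs : ∀ k, s (k + 1) = step k (s k) (u k)) : ∀ k, (k, s k) ∈ reachable step s₀ (u k)
  | 0 => monotone_reachable (Nat.zero_le _) (h₀ ▸ Set.mem_singleton _)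
  | k + 1 => monotone_reachable (hu (Nat.lt_succ_self k))
      (hs k ▸ succ_mem_reachable (mem_reachable_of_strictMono hu h₀ hs k))

end Reachable

/-- Dependent choice along `p`. Only finitely many positions can be reached by moves `< m`, so that
the sets of legal moves in them can be intersected before diagonalizing over `m`. -/
theorem IsSelective.exists_play (hp : IsSelective p) {σ : Type*} (Next : ℕ → σ → ℕ → σ → Prop)
    (hNext : ∀ k s, ∀ᶠ n in (p : Filter ℕ), ∃ s', Next k s n s') (s₀ : σ) :
    ∃ (u : ℕ → ℕ) (s : ℕ → σ), StrictMono u ∧ Set.range u ∈ p ∧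
      ∀ k, Next k (s k) (u k) (s (k + 1)) := by
  let step : ℕ → σ → ℕ → σ := fun k s n => @Classical.epsilon σ ⟨s₀⟩ (Next k s n)
  have hstep : ∀ {k s n}, (∃ s', Next k s n s') → Next k s n (step k s n) := Classical.epsilon_spec
  obtain ⟨U, hU, hdiag⟩ := hp.exists_diagonal
    (W := fun m => {n | ∀ t ∈ reachable step s₀ (m + 1), ∃ s', Next t.1 t.2 n s'})
    fun m => (eventually_all_finite (finite_reachable _)).2 fun t _ => hNext t.1 t.2
  have hV : U ∩ {n | ∃ s', Next 0 s₀ n s'} ∈ p := inter_mem hU (hNext 0 s₀)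
  have hinf : (U ∩ {n | ∃ s', Next 0 s₀ n s'}).Infinite := fun hf =>
    Ultrafilter.compl_mem_iff_notMem.1 (hp.free hf.compl_mem_cofinite) hV
  let u : ℕ → ℕ := Nat.nth (· ∈ U ∩ {n | ∃ s', Next 0 s₀ n s'})
  have hu : StrictMono u := Nat.nth_strictMono hinf
  have huV : ∀ k, u k ∈ U ∩ {n | ∃ s', Next 0 s₀ n s'} := Nat.nth_mem_of_infinite hinf
  let s : ℕ → σ := fun k => Nat.rec s₀ (fun k s => step k s (u k)) k
  have hreach : ∀ k, (k, s k) ∈ reachable step s₀ (u k) :=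
    mem_reachable_of_strictMono hu rfl fun _ => rfl
  refine ⟨u, s, hu, (Nat.range_nth_of_infinite hinf).symm ▸ hV, fun k => hstep ?_⟩
  cases k with
  | zero => exact (huV 0).2
  | succ k =>
    exact hdiag _ (huV k).1 _ (huV (k + 1)).1 (hu (Nat.lt_succ_self k)) _
      (succ_mem_reachable (hreach k))

end Selective

/-! ### Linear functionals that vanish along the ultrafilter -/

section Functional

variable {K V : Type*} [Field K] [AddCommGroup V] [Module K V]

theorem exists_le_vanishing_on (f : V →ₗ.[K] K) {R : Submodule K V} (hR : Disjoint f.domain R)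
    {x : V} (hx : x ∉ f.domain ⊔ R) :
    ∃ g, f ≤ g ∧ g.domain = f.domain ⊔ R ⊔ K ∙ x ∧ (∀ v ∈ R, (v, 0) ∈ g.graph) ∧
      (x, 1) ∈ g.graph := by
  let f₁ : V →ₗ.[K] K := f.sup (LinearMap.toPMap 0 R) (f.sup_h_of_disjoint _ hR)
  have hx₁ : x ∉ f₁.domain := hx
  let g : V →ₗ.[K] K := f₁.supSpanSingleton x 1 hx₁
  have hf₁g : f₁ ≤ g := LinearPMap.left_le_sup _ _ _
  refine ⟨g, (LinearPMap.left_le_sup _ _ _).trans hf₁g, LinearPMap.domain_supSpanSingleton .., ?_,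
    ?_⟩
  · intro v hv
    have hle : LinearMap.toPMap 0 R ≤ g := (LinearPMap.right_le_sup _ _ _).trans hf₁g
    exact LinearPMap.le_graph_of_le hle ((LinearPMap.mem_graph_iff _).2 ⟨⟨v, hv⟩, rfl, rfl⟩)
  · have hxg : x ∈ g.domain := Submodule.mem_sup_right (Submodule.mem_span_singleton_self x)
    exact (LinearPMap.mem_graph_iff _).2
      ⟨⟨x, hxg⟩, rfl, LinearPMap.supSpanSingleton_apply_self f₁ 1 hx₁⟩

theorem exists_linearMap_of_directedOn {W : Type*} [AddCommGroup W] [Module K W]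
    {c : Set (V →ₗ.[K] W)} (hc : DirectedOn (· ≤ ·) c) :
    ∃ ψ : V →ₗ[K] W, ∀ f ∈ c, ∀ v w, (v, w) ∈ f.graph → ψ v = w := by
  obtain ⟨ψ, hψ⟩ := (LinearPMap.sSup c hc).toFun.exists_extend
  refine ⟨ψ, fun f hf v w hvw => ?_⟩
  obtain ⟨y, rfl, rfl⟩ :=
    (LinearPMap.mem_graph_iff _).1 (LinearPMap.le_graph_of_le (LinearPMap.le_sSup hc hf) hvw)
  exact LinearMap.congr_fun hψ y

variable [Finite K] [TopologicalSpace V] [T1Space V] [ContinuousAdd V] [ContinuousConstSMul K V]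
  {α ι : Type*} [Finite ι] {l : Filter α}

theorem eventually_disjoint_span {v : ι → α → V} (hv : ∀ i, Tendsto (v i) l (𝓝 0))
    (E : Submodule K V) [Module.Finite K E] :
    ∀ᶠ n in l, Disjoint E (Submodule.span K (Set.range fun i => v i n)) := by
  have := Fintype.ofFinite ι
  have : Finite E := Module.finite_of_finite K
  have hE : ((E : Set V) \ {0})ᶜ ∈ 𝓝 (0 : V) :=
    ((Set.toFinite (E : Set V)).subset Set.sdiff_subset).isClosed.isOpen_compl.mem_nhds (by simp)
  have hcomb : ∀ᶠ n in l, ∀ c : ι → K, ∑ i, c i • v i n ∉ (E : Set V) \ {0} := by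
    refine eventually_all.2 fun c => Tendsto.eventually_mem ?_ hE
    simpa using tendsto_finsetSum Finset.univ fun i _ => (hv i).const_smul (c i)
  refine hcomb.mono fun n hn => Submodule.disjoint_def.2 fun x hxE hx => ?_
  obtain ⟨c, rfl⟩ := (Submodule.mem_span_range_iff_exists_fun K).1 hx
  exact by_contra fun h => hn c ⟨hxE, h⟩

theorem eventually_exists_extension (f : V →ₗ.[K] K) [Module.Finite K f.domain] {v : ι → α → V}
    (hv : ∀ i, Tendsto (v i) l (𝓝 0)) {X : Set V} (hX : X.Infinite) :
    ∀ᶠ n in l, ∃ g, f ≤ g ∧ Module.Finite K g.domain ∧ (∀ i, (v i n, 0) ∈ g.graph) ∧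
      ∃ x ∈ X, x ∉ f.domain ∧ (x, 1) ∈ g.graph := by
  filter_upwards [eventually_disjoint_span hv f.domain] with n hn
  let R := Submodule.span K (Set.range fun i => v i n)
  have : Module.Finite K R := FiniteDimensional.span_of_finite K (Set.finite_range _)
  have : Finite (f.domain ⊔ R : Submodule K V) := Module.finite_of_finite K
  obtain ⟨x, hxX, hx⟩ := hX.exists_notMem_finite (Set.toFinite (f.domain ⊔ R : Submodule K V))
  obtain ⟨g, hfg, hdom, hgR, hgx⟩ := exists_le_vanishing_on f hn hx
  refine ⟨g, hfg, ?_, fun i => hgR _ (Submodule.subset_span ⟨i, rfl⟩), x, hxX,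
    fun h => hx (Submodule.mem_sup_left h), hgx⟩
  rw [hdom]
  infer_instance

theorem IsSelective.exists_chain {p : Ultrafilter ℕ} (hp : IsSelective p) {v : ℕ → ℕ → V}
    (hv : ∀ i, Tendsto (v i) p (𝓝 0)) {X : Set V} (hX : X.Infinite) :
    ∃ f : ℕ → V →ₗ.[K] K, Monotone f ∧
      (∀ i, ∀ᶠ n in (p : Filter ℕ), ∃ k, (v i n, 0) ∈ (f k).graph) ∧
      ∀ k, ∃ x ∈ X, x ∉ (f k).domain ∧ (x, 1) ∈ (f (k + 1)).graph := by
  let σ := {f : V →ₗ.[K] K // Module.Finite K f.domain}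
  obtain ⟨u, f, hu, hup, hnext⟩ := hp.exists_play
    (fun k (f : σ) n (g : σ) => f.1 ≤ g.1 ∧ (∀ i : Fin k, (v i n, 0) ∈ g.1.graph) ∧
      ∃ x ∈ X, x ∉ f.1.domain ∧ (x, 1) ∈ g.1.graph)
    (fun k f => by
      have := f.2
      filter_upwards [eventually_exists_extension f.1 (fun i : Fin k => hv i) hX]
        with n ⟨g, hfg, hg, h⟩
      exact ⟨⟨g, hg⟩, hfg, h⟩)
    ⟨⊥, inferInstanceAs (Module.Finite K (⊥ : Submodule K V))⟩
  refine ⟨fun k => (f k).1, monotone_nat_of_le_succ fun k => (hnext k).1, fun i => ?_,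
    fun k => (hnext k).2.2⟩
  have hlarge : ∀ᶠ n in (p : Filter ℕ), u i < n :=
    (Nat.cofinite_eq_atTop ▸ hp.free) (eventually_gt_atTop (u i))
  filter_upwards [hup, hlarge] with n ⟨k, hk⟩ hn
  subst hk
  exact ⟨k + 1, (hnext k).2.1 ⟨i, hu.lt_iff_lt.1 hn⟩⟩

theorem IsSelective.exists_functional {p : Ultrafilter ℕ} (hp : IsSelective p)
    {L : Set (ℕ → V)} (hL : L.Countable) (hL₀ : ∀ v ∈ L, Tendsto v p (𝓝 0))
    {X : Set V} (hX : X.Infinite) :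
    ∃ ψ : V →ₗ[K] K, (∀ v ∈ L, ∀ᶠ n in (p : Filter ℕ), ψ (v n) = 0) ∧
      {x | x ∈ X ∧ ψ x = 1}.Infinite := by
  obtain ⟨v, hv⟩ := (hL.insert 0).exists_eq_range (Set.insert_nonempty 0 L)
  have hv₀ : ∀ i, Tendsto (v i) p (𝓝 0) := fun i => by
    rcases hv.symm.subset (Set.mem_range_self i) with h | h
    exacts [h ▸ tendsto_const_nhds, hL₀ _ h]
  obtain ⟨f, hmono, hvanish, hone⟩ := hp.exists_chain (K := K) hv₀ hX
  obtain ⟨ψ, hψ⟩ := exists_linearMap_of_directedOn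
    (directedOn_range.2 hmono.directed_le)
  refine ⟨ψ, fun w hw => ?_, ?_⟩
  · obtain ⟨i, rfl⟩ := hv.subset (Or.inr hw)
    exact (hvanish i).mono fun n ⟨k, hk⟩ => hψ _ ⟨k, rfl⟩ _ _ hk
  · choose x hxX hxf hx1 using hone
    have hinj : Function.Injective x := .of_lt_imp_ne fun k l hkl h =>
      hxf l ((hmono (Nat.succ_le_of_lt hkl)).1 (h ▸ LinearPMap.mem_domain_of_mem_graph (hx1 k)))
    refine (Set.infinite_range_of_injective hinj).mono ?_
    rintro _ ⟨k, rfl⟩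
    exact ⟨hxX k, hψ _ ⟨k + 1, rfl⟩ _ _ (hx1 k)⟩

end Functional

/-! ### The values of the iterated ultrapowers -/

section Values

/-- The compact group `𝕋^{Hom(G, 𝕋)}`. An element `x` of an iterated ultrapower of `G` is
represented in it by the function `Φ ↦ Φ̄ x`. -/
abbrev TorusPower (G : Type) [AddCommGroup G] : Type := (G →+ UnitAddCircle) → UnitAddCircle

/-- The canonical homomorphism `g ↦ (Φ ↦ Φ g)` to the double dual. -/
def evaluation (G : Type) [AddCommGroup G] : G →+ TorusPower G := AddMonoidHom.pi id

variable {I : Type} [LinearOrder I] [WellFoundedLT I]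

/-- The homomorphism `x ↦ (Φ ↦ Φ̄ x)` on the `i`-th iterated ultrapower. -/
def ultEval (p : Ultrafilter ℕ) (G : Type) [AddCommGroup G] (i : I) : ult p G i →+ TorusPower G :=
  AddMonoidHom.pi fun Φ => ext p Φ i

/-- The group of all functions `Φ ↦ Φ̄ x` with `x` in the `i`-th iterated ultrapower, that is, the
Hausdorff quotient of `ult p G i`. -/
def ultRange (p : Ultrafilter ℕ) (G : Type) [AddCommGroup G] (i : I) :
    AddSubgroup (TorusPower G) :=
  (ultEval p G i).range

/-- The homomorphism `x ↦ (Φ ↦ Φ̄ x)` on the direct limit of the iterated ultrapowers before the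
`i`-th one. -/
def limEval (p : Ultrafilter ℕ) (G : Type) [AddCommGroup G] (i : I) :
    ultLim p G i →+ TorusPower G :=
  AddMonoidHom.pi fun Φ => limExt p G i _ (compat_ext p Φ i)

variable {p : Ultrafilter ℕ} {G : Type} [AddCommGroup G] {i : I} {x : TorusPower G}

theorem ultRange_of_isMin (hi : IsMin i) : ultRange p G i = (evaluation G).range := by
  have h : ultEval p G i = (evaluation G).comp (ultEquivBot p G hi).toAddMonoidHom :=
    AddMonoidHom.ext fun a => funext fun Φ => ext_of_isMin p Φ hi a
  have hsurj : (ultEquivBot p G hi).toAddMonoidHom.range = ⊤ :=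
    AddMonoidHom.range_eq_top.2 (ultEquivBot p G hi).surjective
  rw [ultRange, h, AddMonoidHom.range_comp, hsurj, ← AddMonoidHom.range_eq_map]

theorem limEval_toLim (j : {j // j < i}) (a : ult p G j.1) :
    limEval p G i (toLim p G i j a) = ultEval p G j.1 a :=
  funext fun Φ => AddCommGroup.DirectLimit.lift_of (Hg := compat_ext p Φ i) ..

theorem mem_range_limEval (hi : ¬ IsMin i) :
    x ∈ (limEval p G i).range ↔ ∃ j < i, x ∈ ultRange p G j := by
  have : Nonempty {j // j < i} := nonempty_subtype.2 (not_isMin_iff.1 hi)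
  constructor
  · rintro ⟨y, rfl⟩
    induction y using AddCommGroup.DirectLimit.induction_on with
    | _ j a => exact ⟨j.1, j.2, a, (limEval_toLim j a).symm⟩
  · rintro ⟨j, hj, a, rfl⟩
    exact ⟨_, limEval_toLim ⟨j, hj⟩ a⟩

theorem tendsto_limEval (hi : ¬ IsMin i) (f : ℕ → ultLim p G i) :
    Tendsto (fun n => limEval p G i (f n)) p
      (𝓝 (ultEval p G i ((ultEquiv p G hi).symm (f : Ultrapower p (ultLim p G i))))) := by
  refine tendsto_pi_nhds.2 fun Φ => ?_
  change Tendsto _ _ (𝓝 (ext p Φ i _))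
  rw [ext_of_not_isMin]
  exact tendsto_limUnder _ _

theorem mem_ultRange_iff (hi : ¬ IsMin i) :
    x ∈ ultRange p G i ↔
      ∃ f : ℕ → TorusPower G, (∀ n, ∃ j < i, f n ∈ ultRange p G j) ∧ Tendsto f p (𝓝 x) := by
  constructor
  · rintro ⟨a, rfl⟩
    obtain ⟨a, rfl⟩ := (ultEquiv p G hi).symm.surjective a
    induction a using Quotient.inductionOn with
    | _ f => exact ⟨_, fun n => (mem_range_limEval hi).1 ⟨f n, rfl⟩, tendsto_limEval hi f⟩
  · rintro ⟨f, hf, hfx⟩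
    choose a ha using fun n => (mem_range_limEval hi).2 (hf n)
    obtain rfl : (fun n => limEval p G i (a n)) = f := funext ha
    exact ⟨_, tendsto_nhds_unique (tendsto_limEval hi a) hfx⟩

theorem evaluation_mem_torsionBy {q : ℕ} (hG : ∀ g : G, q • g = 0) (g : G) :
    evaluation G g ∈ (TorusPower G)[q] := by
  rw [AddSubgroup.torsionBy.nsmul_iff, ← map_nsmul, hG, map_zero]

theorem isClosed_torsionBy (A : Type*) [AddCommGroup A] [TopologicalSpace A] [ContinuousAdd A]
    [T1Space A] (n : ℕ) : IsClosed (A[n] : Set A) := by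
  have h : (A[n] : Set A) = (n • ·) ⁻¹' {0} := Set.ext fun _ => AddSubgroup.torsionBy.nsmul_iff
  exact h ▸ isClosed_singleton.preimage (continuous_nsmul n)

theorem ultRange_le_torsionBy {q : ℕ} (hG : ∀ g : G, q • g = 0) (i : I) :
    ultRange p G i ≤ (TorusPower G)[q] := by
  induction i using WellFoundedLT.induction with
  | _ i ih =>
    by_cases hi : IsMin i
    · rw [ultRange_of_isMin hi]
      rintro _ ⟨g, rfl⟩
      exact evaluation_mem_torsionBy hG g
    · intro x hx
      obtain ⟨f, hf, hfx⟩ := (mem_ultRange_iff hi).1 hx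
      refine (isClosed_torsionBy _ q).mem_of_tendsto hfx (Eventually.of_forall fun n => ?_)
      obtain ⟨j, hj, hfj⟩ := hf n
      exact ih j hj hfj

theorem exists_lt_top_forall_lt (j : ℕ → OmegaOneIndex) (hj : ∀ n, j n < ⊤) :
    ∃ k < ⊤, ∀ n, j n < k := by
  lift j to ℕ → (Ordinal.omega 1).ToType using fun n => (hj n).ne
  have hcof : ¬ IsCofinal (Set.range j) := fun h => by
    have hle : Cardinal.aleph 1 ≤ Cardinal.mk (Set.range j) := by
      rw [← Cardinal.cof_omega_one, ← Ordinal.cof_toType]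
      exact Order.cof_le h
    exact (hle.trans (Set.countable_range j).le_aleph0).not_gt Cardinal.aleph0_lt_aleph_one
  obtain ⟨k, hk⟩ := not_isCofinal_iff.1 hcof
  exact ⟨k, WithTop.coe_lt_top k, fun n => WithTop.coe_lt_coe.2 (hk _ (Set.mem_range_self n))⟩

theorem not_isMin_top : ¬ IsMin (⊤ : OmegaOneIndex) := by
  have k : (Ordinal.omega 1 : Ordinal.{0}).ToType :=
    Classical.choice (Ordinal.nonempty_toType_iff.2 (Ordinal.omega_pos 1).ne')
  exact (WithTop.coe_lt_top k).not_isMin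

theorem exists_mem_ultRange_lt_top (hx : x ∈ ultRange p G (⊤ : OmegaOneIndex)) :
    ∃ k < (⊤ : OmegaOneIndex), x ∈ ultRange p G k := by
  obtain ⟨f, hf, hfx⟩ := (mem_ultRange_iff not_isMin_top).1 hx
  choose j hj hfj using hf
  obtain ⟨k, hk, hjk⟩ := exists_lt_top_forall_lt j hj
  exact ⟨k, hk, (mem_ultRange_iff (hjk 0).not_isMin).2 ⟨f, fun n => ⟨j n, hjk n, hfj n⟩, hfx⟩⟩

theorem exists_tendsto_ultRange_top {y : ℕ → TorusPower G}
    (hy : ∀ n, y n ∈ ultRange p G (⊤ : OmegaOneIndex)) :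
    ∃ x ∈ ultRange p G (⊤ : OmegaOneIndex), Tendsto y p (𝓝 x) := by
  obtain ⟨x, -, hx⟩ := isCompact_univ.ultrafilter_le_nhds (p.map y) (by simp)
  exact ⟨x, (mem_ultRange_iff not_isMin_top).2 ⟨y, fun n => exists_mem_ultRange_lt_top (hy n), hx⟩,
    hx⟩

end Values

/-! ### Separation by characters -/

section Separation

attribute [local instance] AddSubgroup.torsionBy.zmodModule

theorem continuousConstSMul_zmod (n : ℕ) (A : Type*) [AddCommGroup A] [Module (ZMod n) A]
    [TopologicalSpace A] [IsTopologicalAddGroup A] : ContinuousConstSMul (ZMod n) A := by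
  refine ⟨fun c => ?_⟩
  obtain ⟨k, rfl⟩ := ZMod.intCast_surjective c
  simpa only [Int.cast_smul_eq_zsmul] using continuous_zsmul k

variable {p : Ultrafilter ℕ} {G : Type} [AddCommGroup G] {q : ℕ}

/-- The canonical homomorphism of a group of exponent `q` to the elements of order dividing `q`
in the double dual. -/
def torsionEvaluation (hG : ∀ g : G, q • g = 0) : G →+ (TorusPower G)[q] :=
  (evaluation G).codRestrict _ (evaluation_mem_torsionBy hG)

variable {I : Type} [LinearOrder I] [WellFoundedLT I] {i : I}

/-- The sequences in `L` are the differences `f n - z` for all the `p`-limits `f n → z` by which `x`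
is recursively obtained from points of `G`. -/
theorem exists_countable_determining (hG : ∀ g : G, q • g = 0) (i : I)
    (x : (TorusPower G)[q]) (hx : (x : TorusPower G) ∈ ultRange p G i) :
    ∃ L : Set (ℕ → (TorusPower G)[q]), L.Countable ∧
      (∀ v ∈ L, Tendsto v p (𝓝 0)) ∧
      ∀ χ : (TorusPower G)[q] →+ UnitAddCircle,
        (∀ v ∈ L, ∀ᶠ n in (p : Filter ℕ), χ (v n) = 0) →
        (x : TorusPower G) (χ.comp (torsionEvaluation hG)) = χ x := by
  induction i using WellFoundedLT.induction generalizing x with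
  | _ i ih =>
    by_cases hi : IsMin i
    · rw [ultRange_of_isMin hi] at hx
      obtain ⟨g, hg⟩ := hx
      obtain rfl : torsionEvaluation hG g = x := Subtype.ext hg
      exact ⟨∅, Set.countable_empty, by simp, fun _ _ => rfl⟩
    obtain ⟨f, hf, hfx⟩ := (mem_ultRange_iff hi).1 hx
    choose j hj hfj using hf
    lift f to ℕ → (TorusPower G)[q] using
      fun n => ultRange_le_torsionBy hG _ (hfj n)
    choose L hLc hL₀ hL using fun n => ih (j n) (hj n) (f n) (hfj n)
    refine ⟨insert (fun n => f n - x) (⋃ n, L n), (Set.countable_iUnion hLc).insert _, ?_, ?_⟩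
    · rintro v (rfl | hv)
      · simpa using (tendsto_subtype_rng.2 hfx).sub_const x
      · obtain ⟨n, hn⟩ := Set.mem_iUnion.1 hv
        exact hL₀ n v hn
    · intro χ hχ
      have hχf : ∀ᶠ n in (p : Filter ℕ), χ (f n) = χ x :=
        (hχ _ (Set.mem_insert _ _)).mono fun n hn => sub_eq_zero.1 (map_sub χ _ _ ▸ hn)
      have hcoord : ∀ n, (f n : TorusPower G) (χ.comp (torsionEvaluation hG)) = χ (f n) :=
        fun n => hL n χ fun v hv => hχ v (Or.inr (Set.mem_iUnion_of_mem n hv))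
      refine tendsto_nhds_unique (tendsto_pi_nhds.1 hfx _) ?_
      exact tendsto_const_nhds.congr' (hχf.mono fun n hn => (hcoord n).trans hn |>.symm)

variable [Fact q.Prime]

theorem IsSelective.exists_character (hp : IsSelective p) (hG : ∀ g : G, q • g = 0)
    {X : Set (TorusPower G)} (hXi : X ⊆ ultRange p G i) (hXc : X.Countable) (hX : X.Infinite) :
    ∃ Φ : G →+ UnitAddCircle, {x | x ∈ X ∧ x Φ = ZMod.toAddCircle (1 : ZMod q)}.Infinite := by
  lift X to Set (TorusPower G)[q] using
    fun x hx => ultRange_le_torsionBy hG i (hXi hx)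
  choose L hLc hL₀ hL using fun x : X =>
    exists_countable_determining hG i x.1 (hXi (Set.mem_image_of_mem _ x.2))
  have : Countable X := (hXc.preimage Subtype.val_injective).mono (Set.subset_preimage_image _ _)
  have := continuousConstSMul_zmod q (TorusPower G)[q]
  obtain ⟨ψ, hψL, hψX⟩ := hp.exists_functional (K := ZMod q) (Set.countable_iUnion hLc)
    (fun v hv => let ⟨x, hx⟩ := Set.mem_iUnion.1 hv; hL₀ x v hx) hX.of_image
  let χ : (TorusPower G)[q] →+ UnitAddCircle := ZMod.toAddCircle.comp ψ.toAddMonoidHom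
  have hχ : ∀ x : X, x.1.1 (χ.comp (torsionEvaluation hG)) = ZMod.toAddCircle (ψ x.1) := by
    refine fun x => hL x χ fun v hv => (hψL v (Set.mem_iUnion_of_mem x hv)).mono fun n hn => ?_
    exact ZMod.toAddCircle_eq_zero.2 hn
  refine ⟨χ.comp (torsionEvaluation hG),
    (hψX.image Subtype.val_injective.injOn).mono ?_⟩
  rintro _ ⟨x, ⟨hx, hx1⟩, rfl⟩
  exact ⟨Set.mem_image_of_mem _ hx, hx1 ▸ hχ ⟨x, hx⟩⟩

theorem IsSelective.eventually_eq_zero (hp : IsSelective p) (hG : ∀ g : G, q • g = 0)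
    {y : ℕ → TorusPower G} (hyi : ∀ n, y n ∈ ultRange p G i) (hy : Tendsto y atTop (𝓝 0)) :
    ∀ᶠ n in atTop, y n = 0 := by
  have hfin : (Set.range y \ {0}).Finite := by
    by_contra hinf
    obtain ⟨Φ, hΦ⟩ := hp.exists_character hG
      (Set.sdiff_subset.trans (Set.range_subset_iff.2 hyi))
      ((Set.countable_range y).mono Set.sdiff_subset) hinf
    have hone : (0 : UnitAddCircle) ≠ ZMod.toAddCircle (1 : ZMod q) := by
      exact fun h => one_ne_zero (ZMod.toAddCircle_eq_zero.1 h.symm)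
    have hne : {n | y n Φ = ZMod.toAddCircle (1 : ZMod q)}.Finite := by
      have h : ∀ᶠ n in cofinite, y n Φ ≠ ZMod.toAddCircle (1 : ZMod q) :=
        Nat.cofinite_eq_atTop ▸ (tendsto_pi_nhds.1 hy Φ).eventually_ne hone
      simpa using h
    refine hΦ ((hne.image y).subset ?_)
    rintro _ ⟨⟨⟨n, rfl⟩, -⟩, hn⟩
    exact ⟨n, hn, rfl⟩
  filter_upwards [hy.eventually_mem (hfin.isClosed.isOpen_compl.mem_nhds (by simp))] with n hn
  by_contra h
  exact hn ⟨⟨n, rfl⟩, h⟩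

end Separation

/-! ### The Hausdorff quotient -/

section HausdorffUlt

variable {p : Ultrafilter ℕ} {G : Type} [AddCommGroup G]

theorem mem_commonKernel {x : UltOmegaOne p G} :
    x ∈ commonKernel p G ↔ ultEval p G (⊤ : OmegaOneIndex) x = 0 := by
  simp only [commonKernel, AddSubgroup.mem_iInf, AddMonoidHom.mem_ker, funext_iff]
  rfl

/-- The homomorphism `x ↦ (Φ ↦ Φ̄ x)` on `Ult_p^{ω₁}(G)`. -/
def hausdorffEval (p : Ultrafilter ℕ) (G : Type) [AddCommGroup G] :
    HausdorffUlt p G →+ TorusPower G :=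
  QuotientAddGroup.lift (commonKernel p G) (ultEval p G (⊤ : OmegaOneIndex))
    fun _ hx => mem_commonKernel.1 hx

theorem hausdorffEval_injective : Function.Injective (hausdorffEval p G) := by
  rw [injective_iff_map_eq_zero]
  intro x hx
  obtain ⟨x, rfl⟩ := QuotientAddGroup.mk_surjective x
  exact (QuotientAddGroup.eq_zero_iff x).2 (mem_commonKernel.2 hx)

theorem isEmbedding_hausdorffEval : IsEmbedding (hausdorffEval p G) := by
  refine ⟨⟨TopologicalSpace.ext_iff.2 fun s => ?_⟩, hausdorffEval_injective⟩
  have hind : IsInducing fun x : UltOmegaOne p G => ultEval p G (⊤ : OmegaOneIndex) x :=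
    inducing_iInf_to_pi fun Φ => extOmegaOne p Φ
  have hquot : IsOpen s ↔
      IsOpen ((QuotientAddGroup.mk : UltOmegaOne p G → HausdorffUlt p G) ⁻¹' s) := Iff.rfl
  rw [isOpen_induced_iff, hquot, hind.isOpen_iff]
  refine exists_congr fun t => and_congr_right fun _ => ?_
  rw [← QuotientAddGroup.mk_surjective.preimage_injective.eq_iff]
  rfl

theorem hausdorffEval_mem_ultRange (x : HausdorffUlt p G) :
    hausdorffEval p G x ∈ ultRange p G (⊤ : OmegaOneIndex) := by
  obtain ⟨x, rfl⟩ := QuotientAddGroup.mk_surjective x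
  exact ⟨x, rfl⟩

theorem nsmul_hausdorffUlt_eq_zero {q : ℕ} (hG : ∀ g : G, q • g = 0) (x : HausdorffUlt p G) :
    q • x = 0 := by
  apply hausdorffEval_injective
  rw [map_nsmul, map_zero, ← AddSubgroup.torsionBy.nsmul_iff]
  exact ultRange_le_torsionBy hG _ (hausdorffEval_mem_ultRange x)

theorem isPCompact_hausdorffUlt : IsPCompact p (HausdorffUlt p G) := by
  intro x
  obtain ⟨_, ⟨a, rfl⟩, hxa⟩ :=
    exists_tendsto_ultRange_top fun n => hausdorffEval_mem_ultRange (x n)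
  exact ⟨QuotientAddGroup.mk (s := commonKernel p G) a,
    isEmbedding_hausdorffEval.tendsto_nhds_iff.2 hxa⟩

theorem IsSelective.noNontrivialConvergentSeq (hp : IsSelective p) {q : ℕ} [Fact q.Prime]
    (hG : ∀ g : G, q • g = 0) : NoNontrivialConvergentSeq (HausdorffUlt p G) := by
  intro x a hx
  have hlim : Tendsto (fun n => hausdorffEval p G (x n - a)) atTop (𝓝 0) := by
    have := (isEmbedding_hausdorffEval.tendsto_nhds_iff.1 hx).sub_const (hausdorffEval p G a)
    simpa only [Function.comp_def, ← map_sub, sub_self, map_zero] using this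
  filter_upwards [hp.eventually_eq_zero hG (fun n => hausdorffEval_mem_ultRange (x n - a)) hlim]
    with n hn
  exact sub_eq_zero.1 ((map_eq_zero_iff _ hausdorffEval_injective).1 hn)

end HausdorffUlt

end IteratedUltrapower

end

theorem theorem3p3_general (p : Ultrafilter ℕ) (hp : IteratedUltrapower.IsSelective p)
    {G : Type} [AddCommGroup G] {q : ℕ} [Fact q.Prime] (hG : ∀ g : G, q • g = 0) :
    IsTopologicalAddGroup (IteratedUltrapower.HausdorffUlt p G) ∧
    T2Space (IteratedUltrapower.HausdorffUlt p G) ∧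
    (∀ x : IteratedUltrapower.HausdorffUlt p G, q • x = 0) ∧
    IteratedUltrapower.IsPCompact p (IteratedUltrapower.HausdorffUlt p G) ∧
    IteratedUltrapower.NoNontrivialConvergentSeq (IteratedUltrapower.HausdorffUlt p G) :=
  ⟨IteratedUltrapower.isEmbedding_hausdorffEval.isInducing.topologicalAddGroup
      (IteratedUltrapower.hausdorffEval p G),
    IteratedUltrapower.isEmbedding_hausdorffEval.t2Space,
    IteratedUltrapower.nsmul_hausdorffUlt_eq_zero hG,
    IteratedUltrapower.isPCompact_hausdorffUlt,
    hp.noNontrivialConvergentSeq hG⟩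

theorem theorem3p3 (p : Ultrafilter ℕ) (hp : IteratedUltrapower.IsSelective p) :
    IsTopologicalAddGroup (IteratedUltrapower.HausdorffUlt p IteratedUltrapower.FinSubsets) ∧
    T2Space (IteratedUltrapower.HausdorffUlt p IteratedUltrapower.FinSubsets) ∧
    (∀ x : IteratedUltrapower.HausdorffUlt p IteratedUltrapower.FinSubsets, x + x = 0) ∧
    IteratedUltrapower.IsPCompact p
      (IteratedUltrapower.HausdorffUlt p IteratedUltrapower.FinSubsets) ∧
    IteratedUltrapower.NoNontrivialConvergentSeq
      (IteratedUltrapower.HausdorffUlt p IteratedUltrapower.FinSubsets) := by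
  have hG : ∀ g : IteratedUltrapower.FinSubsets, 2 • g = 0 := fun g =>
    (two_nsmul g).trans (symmDiff_self (ofBoolRing g))
  simpa only [two_nsmul] using theorem3p3_general p hp hG
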